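/- Let $d\ge 2$ and let $\mathcal A\subset \mathrm{SL}(d,\mathbb R)$ be a finite set. Let $G$ be the semigroup generated by $\mathcal A$, and equip $\mathbb{RP}^{d-1}$ with the metric induced by angles. Write $\alpha_1(A)\ge\alpha_2(A)\ge\dots\ge\alpha_d(A)>0$ for the singular values of $A$, and $\mathcal A^n$ for the set of products of $n$ elements of $\mathcal A$. Suppose that $\mathcal A$ is 1-dominated, that is, there are $c>0$ and $\lambda>1$ with $$\frac{\alpha_1(A)}{\alpha_2(A)}\ge c\lambda^n\qquad\text{for all } n \text{ and all } A\in\mathcal A^n,$$ and that $\mathcal A$ is irreducible, that is, no linear subspace of $\mathbb R^d$ other than $\{0\}$ and $\mathbb R^d$ is preserved by all elements of $G$. Call a nonempty compact set $K\subset\mathbb{RP}^{d-1}$ an attractor for $\mathcal A$ if $\mathcal A(K)=K$, where $\mathcal A(B)=\bigcup_{A\in\mathcal A}A(B)$, and there is an open set $U\supset K$ such that for every nonempty compact $B\subset U$ the sets $\mathcal A^k(B)$ converge to $K$ in the Hausdorff metric as $k\to\infty$. Let $$\Lambda_{\mathcal A}=\{\,\mathrm{Im}\,\pi \;:\; \pi\in\overline{\mathbb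 R G},\ \mathrm{rank}(\pi)=1\,\}\subset\mathbb{RP}^{d-1}$$ be the limit set of $\mathcal A$, where $\mathbb R G=\{kA: k\in\mathbb R,\ A\in G\}$ and the closure is taken in the space of $d\times d$ real matrices. Then $\mathcal A$ has a unique attractor $K_{\mathcal A}$, and $K_{\mathcal A}=\Lambda_{\mathcal A}$. -/

import Mathlib

open Filter Topology
open scoped Pointwise ENNReal LinearAlgebra.Projectivization

noncomputable section

namespace SelfProjective

section AngleMetric

variable {V : Type*} [NormedAddCommGroup V] [InnerProductSpace ℝ V]

/-- The acute angle between the lines spanned by two nonzero vectors. -/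
def acuteAngle (v w : V) : ℝ :=
  min (InnerProductGeometry.angle v w) (Real.pi - InnerProductGeometry.angle v w)

lemma acuteAngle_neg_right (v w : V) : acuteAngle v (-w) = acuteAngle v w := by
  unfold acuteAngle
  rw [InnerProductGeometry.angle_neg_right, sub_sub_cancel, min_comm]

lemma acuteAngle_neg_left (v w : V) : acuteAngle (-v) w = acuteAngle v w := by
  unfold acuteAngle
  rw [InnerProductGeometry.angle_neg_left, sub_sub_cancel, min_comm]

lemma acuteAngle_comm (v w : V) : acuteAngle v w = acuteAngle w v := by
  unfold acuteAngle
  rw [InnerProductGeometry.angle_comm]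

lemma acuteAngle_smul_right (v w : V) {r : ℝ} (hr : r ≠ 0) :
    acuteAngle v (r • w) = acuteAngle v w := by
  rcases lt_or_gt_of_ne hr with h | h
  · have h2 : r • w = (-r) • (-w) := by simp
    rw [h2, ← acuteAngle_neg_right v w]
    unfold acuteAngle
    rw [InnerProductGeometry.angle_smul_right_of_pos _ _ (neg_pos.mpr h)]
  · unfold acuteAngle
    rw [InnerProductGeometry.angle_smul_right_of_pos _ _ h]

lemma acuteAngle_le_angle (v w : V) : acuteAngle v w ≤ InnerProductGeometry.angle v w :=
  min_le_left _ _

lemma exists_angle_eq_acuteAngle (v w : V) :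
    ∃ w' : V, (w' = w ∨ w' = -w) ∧ InnerProductGeometry.angle v w' = acuteAngle v w := by
  rcases min_choice (InnerProductGeometry.angle v w)
    (Real.pi - InnerProductGeometry.angle v w) with h | h
  · exact ⟨w, Or.inl rfl, h.symm⟩
  · exact ⟨-w, Or.inr rfl, by rw [InnerProductGeometry.angle_neg_right]; exact h.symm⟩

lemma acuteAngle_triangle (u v w : V) :
    acuteAngle u w ≤ acuteAngle u v + acuteAngle v w := by
  obtain ⟨v', hv', hv⟩ := exists_angle_eq_acuteAngle u v
  obtain ⟨w', hw', hw⟩ := exists_angle_eq_acuteAngle v' w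
  have e1 : acuteAngle u w = acuteAngle u w' := by
    rcases hw' with rfl | rfl
    · rfl
    · rw [acuteAngle_neg_right]
  have e2 : acuteAngle v' w = acuteAngle v w := by
    rcases hv' with rfl | rfl
    · rfl
    · rw [acuteAngle_neg_left]
  rw [e1, ← e2, ← hv, ← hw]
  exact (acuteAngle_le_angle u w').trans (InnerProductGeometry.angle_le_angle_add_angle _ _ _)

/-- The metric induced by angles on the projective space of a real inner product space: the
distance of two lines is the acute angle between them. -/
instance angleMetric : MetricSpace (ℙ ℝ V) where
  dist p q := acuteAngle p.rep q.rep
  dist_self p := by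
    show acuteAngle p.rep p.rep = 0
    unfold acuteAngle
    rw [InnerProductGeometry.angle_self p.rep_nonzero, sub_zero, min_eq_left Real.pi_pos.le]
  dist_comm p q := acuteAngle_comm _ _
  dist_triangle p q r := acuteAngle_triangle _ _ _
  eq_of_dist_eq_zero := by
    intro p q h
    obtain ⟨w, hw, h2⟩ := exists_angle_eq_acuteAngle p.rep q.rep
    have h3 : InnerProductGeometry.angle p.rep w = 0 := h2.trans h
    obtain ⟨-, r, hr, hrw⟩ := InnerProductGeometry.angle_eq_zero_iff.mp h3
    rw [← p.mk_rep, ← q.mk_rep, Projectivization.mk_eq_mk_iff']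
    rcases hw with hw | hw
    · exact ⟨r⁻¹, by rw [← hw, hrw, smul_smul, inv_mul_cancel₀ hr.ne', one_smul]⟩
    · refine ⟨-r⁻¹, ?_⟩
      rw [← neg_neg q.rep, ← hw, hrw, smul_neg, neg_smul, neg_neg, smul_smul,
        inv_mul_cancel₀ hr.ne', one_smul]

/-- The distance may be computed from arbitrary representatives. -/
lemma dist_mk_mk (v w : V) (hv : v ≠ 0) (hw : w ≠ 0) :
    dist (Projectivization.mk ℝ v hv) (Projectivization.mk ℝ w hw) = acuteAngle v w := by
  obtain ⟨a, ha⟩ := Projectivization.exists_smul_eq_mk_rep ℝ v hv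
  obtain ⟨b, hb⟩ := Projectivization.exists_smul_eq_mk_rep ℝ w hw
  show acuteAngle (Projectivization.mk ℝ v hv).rep (Projectivization.mk ℝ w hw).rep = _
  rw [← ha, ← hb, Units.smul_def, Units.smul_def, acuteAngle_smul_right _ _ b.ne_zero,
    acuteAngle_comm, acuteAngle_smul_right _ _ a.ne_zero, acuteAngle_comm]

end AngleMetric

/-- The group `SL(d, ℝ)`. -/
abbrev SL (d : ℕ) : Type := Matrix.SpecialLinearGroup (Fin d) ℝ

/-- The projective space `ℝℙ^(d-1)` of lines in Euclidean `ℝ^d`, with the angle metric. -/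
abbrev RP (d : ℕ) : Type := ℙ ℝ (EuclideanSpace ℝ (Fin d))

/-- The linear map of Euclidean `ℝ^d` given by a matrix. -/
abbrev lin {d : ℕ} (M : Matrix (Fin d) (Fin d) ℝ) :
    EuclideanSpace ℝ (Fin d) →ₗ[ℝ] EuclideanSpace ℝ (Fin d) :=
  Matrix.toEuclideanLin M

lemma lin_injective {d : ℕ} (A : SL d) :
    Function.Injective (lin (A : Matrix (Fin d) (Fin d) ℝ)) := by
  intro x y h
  have h1 : (A : Matrix (Fin d) (Fin d) ℝ).mulVec x.ofLp
      = (A : Matrix (Fin d) (Fin d) ℝ).mulVec y.ofLp := congrArg WithLp.ofLp h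
  have hA : IsUnit (A : Matrix (Fin d) (Fin d) ℝ) := by
    rw [Matrix.isUnit_iff_isUnit_det, A.det_coe]
    exact isUnit_one
  exact WithLp.ofLp_injective 2 (Matrix.mulVec_injective_iff_isUnit.mpr hA h1)

/-- The action of `A ∈ SL(d, ℝ)` on projective space. -/
def projMap {d : ℕ} (A : SL d) : RP d → RP d :=
  Projectivization.map (lin (A : Matrix (Fin d) (Fin d) ℝ)) (lin_injective A)

/-- The semigroup `G` generated by `𝒜` (all products of one or more elements of `𝒜`). -/
def semigroup {d : ℕ} (𝒜 : Set (SL d)) : Subsemigroup (SL d) := Subsemigroup.closure 𝒜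

/-- `ℝG`, the set of all real multiples of elements of `G`, as a set of matrices. -/
def scalarMultiples {d : ℕ} (𝒜 : Set (SL d)) : Set (Matrix (Fin d) (Fin d) ℝ) :=
  {M | ∃ k : ℝ, ∃ A ∈ semigroup 𝒜, M = k • (A : Matrix (Fin d) (Fin d) ℝ)}

/-- The limit set `Λ_𝒜`: the lines that are images of rank one elements of the closure of `ℝG`. -/
def limitSet {d : ℕ} (𝒜 : Set (SL d)) : Set (RP d) :=
  {x | ∃ π ∈ closure (scalarMultiples 𝒜), π.rank = 1 ∧ x.submodule = LinearMap.range (lin π)}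

/-- `𝒜` is irreducible: no linear subspace other than `0` and `ℝ^d` is preserved by all elements
of `G`. -/
def Irred {d : ℕ} (𝒜 : Set (SL d)) : Prop :=
  ∀ L : Submodule ℝ (EuclideanSpace ℝ (Fin d)),
    (∀ A ∈ semigroup 𝒜, L.map (lin (A : Matrix (Fin d) (Fin d) ℝ)) ≤ L) → L = ⊥ ∨ L = ⊤

/-- The `i`-th largest singular value `α_i(A)`, with `i = 1, …, d`; Mathlib counts from zero. -/
def singVal {d : ℕ} (i : ℕ) (A : SL d) : ℝ :=
  (lin (A : Matrix (Fin d) (Fin d) ℝ)).singularValues (i - 1)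

/-- `𝒜` is 1-dominated: `α₁(A) / α₂(A) ≥ c λⁿ` for all `n` and all products `A` of `n` elements
of `𝒜`, with constants `c > 0` and `λ > 1`. Here `𝒜 ^ n` is the set of all such products. -/
def OneDominated {d : ℕ} (𝒜 : Set (SL d)) : Prop :=
  ∃ c : ℝ, 0 < c ∧ ∃ l : ℝ, 1 < l ∧
    ∀ n : ℕ, ∀ A ∈ 𝒜 ^ n, c * l ^ n ≤ singVal 1 A / singVal 2 A

/-- `𝒜(B)`, the union of the images of `B` under the elements of `𝒜`. -/
def ifs {d : ℕ} (𝒜 : Set (SL d)) (B : Set (RP d)) : Set (RP d) :=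
  ⋃ A ∈ 𝒜, projMap A '' B

/-- The set `K` (nonempty and compact) is an attractor for `𝒜`: `𝒜(K) = K`, and some open set `U`
(a basin of attraction) contains `K` and has the property that `𝒜^k(B)` converges to `K` in the
Hausdorff metric for every nonempty compact `B ⊆ U`. -/
def IsAttractor {d : ℕ} (𝒜 : Set (SL d)) (K : Set (RP d)) : Prop :=
  K.Nonempty ∧ IsCompact K ∧ ifs 𝒜 K = K ∧
    ∃ U : Set (RP d), IsOpen U ∧ K ⊆ U ∧
      ∀ B : Set (RP d), B.Nonempty → IsCompact B → B ⊆ U →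
        Tendsto (fun k : ℕ => Metric.hausdorffEDist ((ifs 𝒜)^[k] B) K) atTop (𝓝 0)

end SelfProjective

end

/-! Domination says that a product `A` of `n` factors is, up to a relative error of order `τ ^ n`,
the rank one map `x ↦ ‖A‖ ⟨v A, x⟩ u A` built from its top singular vectors
(`exists_rankOneApprox`). Appending factors on the right hardly moves the direction `u A`
(`angle_mul_le`). A rank one matrix in the closure of `ℝG` is a limit of multiples of ever longer
products, so every `A` in `𝒜 ^ n` sends the whole limit set `Λ` into a ball of radius `O(τ ^ n)`
about `u A` (`angle_le_of_mem_limitSet`).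

The crux is to extend this contraction to a neighbourhood of `Λ`. For this `Λ` must stay uniformly
away from the kernels of the rank one maps: `‖A‖ ‖w‖ ≤ K ‖A w‖` on lines of `Λ`
(`exists_norm_mul_le`). Each new factor on the left worsens the constant by at most `1 + F * τ ^ n`,
and the infinite product converges. A small thickening of `Λ` is then a basin, since `Λ` is compact
and equal to the union of its images under words of any fixed length.

For uniqueness, a rank one limit carries some point of the basin of any attractor `K` into the basin
of `Λ`. The orbit of that point accumulates on all of `Λ`, so `Λ ⊆ K`. Hence `Λ` lies in the basin
of `K`, and its constant iterates converge to `K`. Irreducibility supplies that `𝒜` is nonempty. -/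

noncomputable section

namespace SelfProjective

/-! ### Singular values and rank one approximation. -/

section SingularValues

variable {E : Type*} [NormedAddCommGroup E] [InnerProductSpace ℝ E] [FiniteDimensional ℝ E]

lemma norm_sq_map_eq_sum (T : E →ₗ[ℝ] E) (y : E) :
    ‖T y‖ ^ 2 = ∑ i : Fin (Module.finrank ℝ E), T.singularValues i ^ 2 *
      (inner ℝ (T.isSymmetric_adjoint_comp_self.eigenvectorBasis rfl i) y) ^ 2 := by
  set b := T.isSymmetric_adjoint_comp_self.eigenvectorBasis rfl with hb
  have h1 : ‖T y‖ ^ 2 = inner ℝ ((T.adjoint ∘ₗ T) y) y := by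
    rw [LinearMap.comp_apply, LinearMap.adjoint_inner_left, real_inner_self_eq_norm_sq]
  rw [h1, ← b.sum_inner_mul_inner]
  refine Finset.sum_congr rfl fun i _ => ?_
  rw [T.sq_singularValues_fin rfl i]
  have := T.isSymmetric_adjoint_comp_self.eigenvectorBasis_apply_self_apply rfl y i
  rw [OrthonormalBasis.repr_apply_apply, OrthonormalBasis.repr_apply_apply] at this
  rw [real_inner_comm, this]
  simp only [RCLike.ofReal_real_eq_id, id_eq, ← hb]
  ring

/-- Only singular directions that `y` actually meets count. For `y` orthogonal to the top one this
gives the second singular value as a bound. -/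
lemma norm_map_le_of_singularValues_le (T : E →ₗ[ℝ] E) (y : E) (s : ℝ)
    (h : ∀ i : Fin (Module.finrank ℝ E), inner ℝ (T.isSymmetric_adjoint_comp_self.eigenvectorBasis rfl i) y ≠ 0 →
      T.singularValues i ≤ s) (hs : 0 ≤ s) : ‖T y‖ ≤ s * ‖y‖ := by
  refine le_of_sq_le_sq ?_ (by positivity)
  rw [norm_sq_map_eq_sum, mul_pow,
    ← (T.isSymmetric_adjoint_comp_self.eigenvectorBasis rfl).sum_sq_inner_right y, Finset.mul_sum]
  refine Finset.sum_le_sum fun i _ => ?_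
  by_cases hi : inner ℝ (T.isSymmetric_adjoint_comp_self.eigenvectorBasis rfl i) y = 0
  · simp [hi]
  · have := h i hi
    have := T.singularValues_nonneg i
    gcongr

lemma norm_map_le_singularValues_zero (T : E →ₗ[ℝ] E) (y : E) :
    ‖T y‖ ≤ T.singularValues 0 * ‖y‖ :=
  norm_map_le_of_singularValues_le T y _ (fun _ _ => T.singularValues_antitone (Nat.zero_le _))
    (T.singularValues_nonneg 0)

/-- Up to an error of the size of the second singular value, an injective endomorphism has
rank one. -/
lemma exists_rank_one_approx (T : E →ₗ[ℝ] E) (hT : Function.Injective T)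
    (hd : 0 < Module.finrank ℝ E) :
    ∃ u v : E, ‖u‖ = 1 ∧ ‖v‖ = 1 ∧ T v = T.singularValues 0 • u ∧
      ∀ x, ‖T x - (T.singularValues 0 * inner ℝ v x) • u‖ ≤ T.singularValues 1 * ‖x‖ := by
  have hpos : 0 < T.singularValues 0 :=
    T.injective_iff_forall_lt_finrank_singularValues_pos.mp hT 0 hd
  set b := T.isSymmetric_adjoint_comp_self.eigenvectorBasis rfl with hb
  set v := b ⟨0, hd⟩ with hv
  have hvn : ‖v‖ = 1 := b.norm_eq_one _
  have hTv : ‖T v‖ = T.singularValues 0 := by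
    refine (sq_eq_sq₀ (norm_nonneg _) hpos.le).mp ?_
    rw [norm_sq_map_eq_sum, Finset.sum_eq_single ⟨0, hd⟩]
    · rw [← hb, ← hv, real_inner_self_eq_norm_sq, hvn]; simp
    · intro i _ hi
      rw [← hb, hv, b.inner_eq_zero hi]; simp
    · simp
  refine ⟨(T.singularValues 0)⁻¹ • T v, v, ?_, hvn, ?_, fun x => ?_⟩
  · rw [norm_smul, hTv, norm_inv, Real.norm_of_nonneg hpos.le, inv_mul_cancel₀ hpos.ne']
  · rw [smul_inv_smul₀ hpos.ne']
  · have h1 : T x - (T.singularValues 0 * inner ℝ v x) • (T.singularValues 0)⁻¹ • T v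
        = T (x - (inner ℝ v x : ℝ) • v) := by
      rw [smul_smul, map_sub, map_smul, mul_right_comm, mul_inv_cancel₀ hpos.ne', one_mul]
    have h0 : (inner ℝ v (x - (inner ℝ v x : ℝ) • v) : ℝ) = 0 := by
      rw [inner_sub_right, inner_smul_right, real_inner_self_eq_norm_sq, hvn]; ring
    have h2 : ‖x - (inner ℝ v x : ℝ) • v‖ ≤ ‖x‖ := by
      refine le_of_sq_le_sq ?_ (norm_nonneg _)
      rw [norm_sub_sq_real, inner_smul_right, norm_smul, hvn, real_inner_comm x v,
        mul_one, Real.norm_eq_abs, sq_abs]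
      nlinarith [sq_nonneg (inner ℝ v x : ℝ)]
    rw [h1]
    refine (norm_map_le_of_singularValues_le T _ (T.singularValues 1) (fun i hi => ?_)
      (T.singularValues_nonneg 1)).trans (by
        gcongr; exact T.singularValues_nonneg 1)
    refine T.singularValues_antitone ?_
    by_contra hlt
    have : i = ⟨0, hd⟩ := Fin.ext (by simpa using hlt)
    exact hi (by rw [this, ← hb]; exact h0)

end SingularValues

/-! ### Angles between lines and distances from vectors to lines. -/

section Angles

variable {V : Type*} [NormedAddCommGroup V] [InnerProductSpace ℝ V]

lemma acuteAngle_nonneg (v w : V) : 0 ≤ acuteAngle v w :=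
  le_min (InnerProductGeometry.angle_nonneg _ _)
    (sub_nonneg.mpr (InnerProductGeometry.angle_le_pi _ _))

lemma acuteAngle_le_pi_div_two (v w : V) : acuteAngle v w ≤ Real.pi / 2 := by
  unfold acuteAngle
  rcases le_total (InnerProductGeometry.angle v w) (Real.pi / 2) with h | h
  · exact (min_le_left _ _).trans h
  · exact (min_le_right _ _).trans (by linarith)

lemma acuteAngle_smul_left (v w : V) {r : ℝ} (hr : r ≠ 0) :
    acuteAngle (r • v) w = acuteAngle v w := by
  rw [acuteAngle_comm, acuteAngle_smul_right _ _ hr, acuteAngle_comm]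

lemma acuteAngle_self {v : V} (hv : v ≠ 0) : acuteAngle v v = 0 :=
  le_antisymm ((acuteAngle_le_angle v v).trans (InnerProductGeometry.angle_self hv).le)
    (acuteAngle_nonneg _ _)

lemma sin_acuteAngle (v w : V) :
    Real.sin (acuteAngle v w) = Real.sin (InnerProductGeometry.angle v w) := by
  unfold acuteAngle
  rcases min_choice (InnerProductGeometry.angle v w)
    (Real.pi - InnerProductGeometry.angle v w) with h | h
  · rw [h]
  · rw [h, Real.sin_pi_sub]

lemma norm_sub_proj_eq (x : V) {u : V} (hu : ‖u‖ = 1) :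
    ‖x - (inner ℝ u x : ℝ) • u‖ = ‖x‖ * Real.sin (acuteAngle x u) := by
  have h := InnerProductGeometry.sin_angle_mul_norm_mul_norm x u
  rw [hu, mul_one, real_inner_self_eq_norm_sq, real_inner_self_eq_norm_sq, hu] at h
  rw [sin_acuteAngle, mul_comm, h, eq_comm, Real.sqrt_eq_iff_mul_self_eq]
  · rw [← sq, ← sq, norm_sub_sq_real, inner_smul_right, norm_smul, hu, real_inner_comm u x,
      mul_one, Real.norm_eq_abs, sq_abs]
    ring
  · have := real_inner_mul_inner_self_le x u
    rw [real_inner_self_eq_norm_sq, real_inner_self_eq_norm_sq, hu] at this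
    linarith
  · positivity

lemma norm_sub_proj_le (x : V) {u : V} (hu : ‖u‖ = 1) :
    ‖x - (inner ℝ u x : ℝ) • u‖ ≤ ‖x‖ * acuteAngle x u := by
  rw [norm_sub_proj_eq x hu]
  gcongr
  exact Real.sin_le (acuteAngle_nonneg _ _)

lemma norm_sub_proj_le_norm_sub (x : V) {u : V} (hu : ‖u‖ = 1) (c : ℝ) :
    ‖x - (inner ℝ u x : ℝ) • u‖ ≤ ‖x - c • u‖ := by
  refine le_of_sq_le_sq ?_ (norm_nonneg _)
  rw [norm_sub_sq_real, norm_sub_sq_real, inner_smul_right, inner_smul_right, norm_smul,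
    norm_smul, hu, real_inner_comm x u, mul_one, mul_one, Real.norm_eq_abs, Real.norm_eq_abs,
    sq_abs, sq_abs]
  nlinarith [sq_nonneg ((inner ℝ x u : ℝ) - c)]

/-- The orthogonal projection minimises the distance to the line of `u`, and Jordan's inequality
with `π ≤ 4` gives `θ ≤ 2 sin θ` on `[0, π / 2]`. -/
lemma norm_mul_acuteAngle_le (x : V) {u : V} (hu : ‖u‖ = 1) (c : ℝ) :
    ‖x‖ * acuteAngle x u ≤ 2 * ‖x - c • u‖ := by
  have h1 := (norm_sub_proj_eq x hu).symm.trans_le (norm_sub_proj_le_norm_sub x hu c)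
  have h2 := Real.mul_le_sin (acuteAngle_nonneg x u) (acuteAngle_le_pi_div_two x u)
  have h3 : acuteAngle x u ≤ 2 * Real.sin (acuteAngle x u) := by
    have h4 : 1 / 2 ≤ 2 / Real.pi := by
      rw [div_le_div_iff₀ two_pos Real.pi_pos]; linarith [Real.pi_le_four]
    nlinarith [acuteAngle_nonneg x u]
  nlinarith [norm_nonneg x]

lemma continuousAt_acuteAngle {x y : V} (hx : x ≠ 0) (hy : y ≠ 0) :
    ContinuousAt (fun p : V × V => acuteAngle p.1 p.2) (x, y) := by
  have h := InnerProductGeometry.continuousAt_angle (x := (x, y)) hx hy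
  exact h.min (continuousAt_const.sub h)

lemma tendsto_acuteAngle {ι : Type*} {l : Filter ι} {f g : ι → V} {x y : V} (hx : x ≠ 0)
    (hy : y ≠ 0) (hf : Tendsto f l (𝓝 x)) (hg : Tendsto g l (𝓝 y)) :
    Tendsto (fun i => acuteAngle (f i) (g i)) l (𝓝 (acuteAngle x y)) := by
  have h : Tendsto (fun p : V × V => acuteAngle p.1 p.2) (𝓝 (x, y)) (𝓝 (acuteAngle x y)) :=
    continuousAt_acuteAngle hx hy
  simpa only [Function.comp_def] using h.comp (hf.prodMk_nhds hg)

lemma eq_mk_of_mem_submodule {p : ℙ ℝ V} {v : V} (hv : v ≠ 0) (hp : v ∈ p.submodule) :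
    p = Projectivization.mk ℝ v hv := by
  rw [Projectivization.submodule_eq, Submodule.mem_span_singleton] at hp
  obtain ⟨a, ha⟩ := hp
  rw [eq_comm, ← p.mk_rep, Projectivization.mk_eq_mk_iff']
  exact ⟨a, ha⟩

lemma dist_eq_acuteAngle {p q : ℙ ℝ V} {v w : V} (hv : v ≠ 0) (hw : w ≠ 0)
    (hp : v ∈ p.submodule) (hq : w ∈ q.submodule) : dist p q = acuteAngle v w := by
  rw [eq_mk_of_mem_submodule hv hp, eq_mk_of_mem_submodule hw hq, dist_mk_mk]

lemma mem_submodule_mk {v : V} (hv : v ≠ 0) : v ∈ (Projectivization.mk ℝ v hv).submodule :=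
  Submodule.mem_span_singleton_self v

lemma rep_mem_submodule (p : ℙ ℝ V) : p.rep ∈ p.submodule := by
  rw [Projectivization.submodule_eq]
  exact Submodule.mem_span_singleton_self _

end Angles

/-! ### Linear and projective actions; dominant directions of products. -/

section

variable {d : ℕ}

/-- Euclidean space `ℝ^d`. -/
abbrev Euc (d : ℕ) : Type := EuclideanSpace ℝ (Fin d)

/-- The action of a matrix on Euclidean space, as a continuous linear map. -/
def opMap (M : Matrix (Fin d) (Fin d) ℝ) : Euc d →L[ℝ] Euc d := Matrix.toEuclideanCLM (𝕜 := ℝ) M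

/-- The action of `A ∈ SL(d, ℝ)` on Euclidean space. -/
def act (A : SL d) : Euc d →L[ℝ] Euc d := opMap (A : Matrix (Fin d) (Fin d) ℝ)

lemma opMap_apply (M : Matrix (Fin d) (Fin d) ℝ) (x : Euc d) : opMap M x = lin M x := rfl

lemma opMap_mul (M N : Matrix (Fin d) (Fin d) ℝ) : opMap (M * N) = opMap M * opMap N :=
  map_mul _ _ _

lemma opMap_smul (k : ℝ) (M : Matrix (Fin d) (Fin d) ℝ) : opMap (k • M) = k • opMap M :=
  map_smul (Matrix.toEuclideanCLM (𝕜 := ℝ) (n := Fin d)) k M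

lemma continuous_opMap : Continuous (opMap (d := d)) :=
  LinearMap.continuous_of_finiteDimensional
    ((Matrix.toEuclideanCLM (𝕜 := ℝ) (n := Fin d)).toAlgEquiv.toLinearMap)

lemma act_mul (A B : SL d) : act (A * B) = act A * act B := by
  unfold act
  rw [Matrix.SpecialLinearGroup.coe_mul, opMap_mul]

lemma act_mul_apply (A B : SL d) (x : Euc d) : act (A * B) x = act A (act B x) := by
  rw [act_mul]; rfl

lemma act_one : act (1 : SL d) = 1 := map_one (Matrix.toEuclideanCLM (𝕜 := ℝ) (n := Fin d))

lemma act_inv_apply_act (A : SL d) (x : Euc d) : act A⁻¹ (act A x) = x := by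
  rw [← act_mul_apply, inv_mul_cancel, act_one]; rfl

lemma act_ne_zero (A : SL d) {x : Euc d} (hx : x ≠ 0) : act A x ≠ 0 := by
  intro h
  apply hx
  rw [← act_inv_apply_act A x, h, map_zero]

lemma norm_act_mul_le (A B : SL d) : ‖act (A * B)‖ ≤ ‖act A‖ * ‖act B‖ := by
  rw [act_mul]; exact norm_mul_le _ _

lemma norm_act_le_mul_inv (A B : SL d) : ‖act A‖ ≤ ‖act (A * B)‖ * ‖act B⁻¹‖ := by
  simpa using norm_act_mul_le (A * B) B⁻¹

lemma norm_le_norm_act_inv_mul (A : SL d) (x : Euc d) : ‖x‖ ≤ ‖act A⁻¹‖ * ‖act A x‖ := by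
  simpa only [act_inv_apply_act] using (act A⁻¹).le_opNorm (act A x)

lemma act_mem_submodule (A : SL d) {p : RP d} {x : Euc d} (hx : x ∈ p.submodule) :
    act A x ∈ (projMap A p).submodule := by
  rcases eq_or_ne x 0 with rfl | h0
  · rw [map_zero]; exact Submodule.zero_mem _
  · rw [eq_mk_of_mem_submodule h0 hx]
    exact Submodule.mem_span_singleton_self _

lemma projMap_mul (A B : SL d) (p : RP d) : projMap (A * B) p = projMap A (projMap B p) := by
  have h := act_mem_submodule A (act_mem_submodule B (rep_mem_submodule p))
  have h' := act_mem_submodule (A * B) (rep_mem_submodule p)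
  have h0 := act_ne_zero (A * B) p.rep_nonzero
  rw [← act_mul_apply] at h
  rw [eq_mk_of_mem_submodule h0 h, eq_mk_of_mem_submodule h0 h']

lemma projMap_one (p : RP d) : projMap 1 p = p := by
  have h := act_mem_submodule 1 (rep_mem_submodule p)
  rw [act_one] at h
  rw [eq_mk_of_mem_submodule p.rep_nonzero h,
    ← eq_mk_of_mem_submodule p.rep_nonzero (rep_mem_submodule p)]

lemma submodule_projMap (A : SL d) (p : RP d) :
    (projMap A p).submodule = p.submodule.map (lin (A : Matrix (Fin d) (Fin d) ℝ)) := by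
  have h := act_mem_submodule A (rep_mem_submodule p)
  rw [eq_mk_of_mem_submodule (act_ne_zero A p.rep_nonzero) h, Projectivization.submodule_mk,
    p.submodule_eq, Submodule.map_span, Set.image_singleton]
  rfl

/-- The matrices in `𝒜 ^ n` are close to rank one maps, with an error that is exponentially small
relative to their norm: `u A` spans the image and `v A` the coimage of the rank one map. -/
structure RankOneApprox (𝒜 : Set (SL d)) (u v : SL d → Euc d) (C τ M : ℝ) : Prop where
  norm_u : ∀ A, ‖u A‖ = 1
  norm_v : ∀ A, ‖v A‖ = 1
  act_v : ∀ A, act A (v A) = ‖act A‖ • u A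
  C_pos : 0 < C
  τ_pos : 0 < τ
  τ_lt_one : τ < 1
  M_pos : 0 < M
  norm_act_le : ∀ a ∈ 𝒜, ‖act a‖ ≤ M
  norm_act_inv_le : ∀ a ∈ 𝒜, ‖act a⁻¹‖ ≤ M
  approx : ∀ n, ∀ A ∈ 𝒜 ^ n, ∀ x,
    ‖act A x - (‖act A‖ * inner ℝ (v A) x) • u A‖ ≤ C * τ ^ n * ‖act A‖ * ‖x‖

lemma norm_act_pos (hd : 2 ≤ d) (A : SL d) : 0 < ‖act A‖ := by
  have : Nonempty (Fin d) := ⟨⟨0, by omega⟩⟩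
  obtain ⟨x, hx⟩ := exists_ne (0 : Euc d)
  rw [norm_pos_iff]
  intro h
  exact act_ne_zero A hx (by rw [h]; rfl)

lemma exists_rankOneApprox (hd : 2 ≤ d) {𝒜 : Set (SL d)} (hfin : 𝒜.Finite)
    (hdom : OneDominated 𝒜) : ∃ u v C τ M, RankOneApprox 𝒜 u v C τ M := by
  have key : ∀ A : SL d, ∃ u v : Euc d, ‖u‖ = 1 ∧ ‖v‖ = 1 ∧ act A v = ‖act A‖ • u ∧
      singVal 1 A = ‖act A‖ ∧
      ∀ x, ‖act A x - (‖act A‖ * inner ℝ v x) • u‖ ≤ singVal 2 A * ‖x‖ := by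
    intro A
    obtain ⟨u, v, hu, hv, huv, h⟩ := exists_rank_one_approx
      (lin (A : Matrix (Fin d) (Fin d) ℝ)) (lin_injective A) (by rw [finrank_euclideanSpace_fin]; omega)
    have hs : singVal 1 A = ‖act A‖ := by
      refine le_antisymm ?_ ?_
      · have h1 := (act A).le_opNorm v
        have h2 : act A v = singVal 1 A • u := huv
        rw [h2, norm_smul, hu, hv, mul_one, mul_one] at h1
        exact (le_abs_self _).trans h1
      · exact (act A).opNorm_le_bound (LinearMap.singularValues_nonneg _ _)
          (norm_map_le_singularValues_zero _)
    refine ⟨u, v, hu, hv, ?_, hs, ?_⟩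
    · rw [← hs]; exact huv
    · rw [← hs]; exact h
  choose u v hu hv huv hs h using key
  obtain ⟨c, hc, l, hl, hdom⟩ := hdom
  obtain ⟨M₁, hM₁⟩ := (hfin.image fun a => ‖act a‖).bddAbove
  obtain ⟨M₂, hM₂⟩ := (hfin.image fun a => ‖act a⁻¹‖).bddAbove
  have hl0 : 0 < l := one_pos.trans hl
  refine ⟨u, v, c⁻¹, l⁻¹, max (max M₁ M₂) 1, hu, hv, huv, inv_pos.mpr hc, inv_pos.mpr hl0,
    inv_lt_one_of_one_lt₀ hl, by positivity, fun a ha => ?_, fun a ha => ?_,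
    fun n A hA x => (h A x).trans ?_⟩
  · exact (hM₁ (Set.mem_image_of_mem _ ha)).trans ((le_max_left _ _).trans (le_max_left _ _))
  · exact (hM₂ (Set.mem_image_of_mem _ ha)).trans ((le_max_right _ _).trans (le_max_left _ _))
  · gcongr
    have h1 := hdom n A hA
    have h2 : 0 < singVal 2 A := by
      refine lt_of_le_of_ne (LinearMap.singularValues_nonneg _ _) fun h0 => ?_
      rw [← h0, div_zero] at h1
      exact absurd h1 (not_le.mpr (by positivity))
    rw [le_div_iff₀ h2, hs] at h1
    rw [inv_pow, ← mul_inv, ← div_eq_inv_mul, le_div_iff₀' (by positivity)]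
    exact h1

namespace RankOneApprox

variable {𝒜 : Set (SL d)} {u v : SL d → Euc d} {C τ M : ℝ}

/-- The angle is weighted by `‖act A x‖` because it is uncontrolled for vectors that `A` nearly
annihilates. Dividing by this norm is possible only after a lower bound for it. -/
lemma norm_mul_angle_le (h : RankOneApprox 𝒜 u v C τ M) {n : ℕ} {A : SL d} (hA : A ∈ 𝒜 ^ n)
    (x : Euc d) : ‖act A x‖ * acuteAngle (act A x) (u A) ≤ 2 * C * τ ^ n * ‖act A‖ * ‖x‖ := by
  have h1 := norm_mul_acuteAngle_le (act A x) (h.norm_u A) (‖act A‖ * inner ℝ (v A) x)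
  have h2 := h.approx n A hA x
  linarith

/-- The vector `a (v (A * a))` is sent by `A` to a multiple of `u (A * a)` of norm `‖A * a‖`, which
is at least `‖A‖ / M`. So `A` does not contract it too much, and its image is close to `u A`. -/
lemma angle_mul_right_le (h : RankOneApprox 𝒜 u v C τ M) (hd : 2 ≤ d) {n : ℕ} {A a : SL d}
    (hA : A ∈ 𝒜 ^ n) (ha : a ∈ 𝒜) :
    acuteAngle (u A) (u (A * a)) ≤ 2 * C * M ^ 2 * τ ^ n := by
  have hpos := norm_act_pos hd (A * a)
  have h1 := h.norm_mul_angle_le hA (act a (v (A * a)))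
  rw [← act_mul_apply, h.act_v, acuteAngle_smul_left _ _ hpos.ne', norm_smul, norm_norm,
    h.norm_u, mul_one, acuteAngle_comm] at h1
  have h2 : ‖act a (v (A * a))‖ ≤ M := by
    have := (act a).le_opNorm (v (A * a))
    rw [h.norm_v, mul_one] at this
    exact this.trans (h.norm_act_le a ha)
  have h3 : ‖act A‖ ≤ ‖act (A * a)‖ * M := (norm_act_le_mul_inv A a).trans
    (by gcongr; exact h.norm_act_inv_le a ha)
  have hC := h.C_pos
  have hτ := h.τ_pos
  have hM := h.M_pos
  refine le_of_mul_le_mul_left (h1.trans ?_) hpos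
  calc 2 * C * τ ^ n * ‖act A‖ * ‖act a (v (A * a))‖
      ≤ 2 * C * τ ^ n * (‖act (A * a)‖ * M) * M := by gcongr
    _ = ‖act (A * a)‖ * (2 * C * M ^ 2 * τ ^ n) := by ring

lemma angle_mul_le (h : RankOneApprox 𝒜 u v C τ M) (hd : 2 ≤ d) {n m : ℕ} {A R : SL d}
    (hA : A ∈ 𝒜 ^ n) (hR : R ∈ 𝒜 ^ m) :
    acuteAngle (u A) (u (A * R)) ≤ 2 * C * M ^ 2 / (1 - τ) * τ ^ n := by
  have hC := h.C_pos
  have hτ := h.τ_pos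
  have hτ1 : 0 < 1 - τ := sub_pos.mpr h.τ_lt_one
  -- The factor `1 - τ ^ m` is the partial geometric sum of the errors times `1 - τ`; it makes the
  -- induction close with a bound uniform in `m`.
  have key : ∀ m, ∀ R ∈ 𝒜 ^ m,
      acuteAngle (u A) (u (A * R)) ≤ 2 * C * M ^ 2 / (1 - τ) * (1 - τ ^ m) * τ ^ n := by
    intro m
    induction m with
    | zero =>
      intro R hR
      rw [pow_zero, Set.mem_one] at hR
      rw [hR, mul_one, acuteAngle_self (norm_ne_zero_iff.mp (by rw [h.norm_u]; exact one_ne_zero))]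
      simp
    | succ m ih =>
      intro R hR
      rw [pow_succ] at hR
      obtain ⟨R', hR', a, ha, rfl⟩ := Set.mem_mul.mp hR
      have h1 := ih R' hR'
      have hAR : A * R' ∈ 𝒜 ^ (n + m) := by rw [pow_add]; exact Set.mul_mem_mul hA hR'
      have h2 := h.angle_mul_right_le hd hAR ha
      rw [← mul_assoc]
      refine (acuteAngle_triangle _ (u (A * R')) _).trans ((add_le_add h1 h2).trans_eq ?_)
      field_simp
      ring
  refine (key m R hR).trans ?_
  have : 1 - τ ^ m ≤ 1 := by linarith [pow_pos hτ m]
  gcongr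
  exact mul_le_of_le_one_right (by positivity) this

end RankOneApprox

end

/-! ### The limit set and its invariance. -/

section

variable {d : ℕ} {𝒜 : Set (SL d)}

lemma mem_semigroup_of_mem_pow {n : ℕ} {A : SL d} (hA : A ∈ 𝒜 ^ (n + 1)) : A ∈ semigroup 𝒜 := by
  induction n generalizing A with
  | zero => rw [zero_add, pow_one] at hA; exact Subsemigroup.subset_closure hA
  | succ n ih =>
    rw [pow_succ] at hA
    obtain ⟨B, hB, a, ha, rfl⟩ := Set.mem_mul.mp hA
    exact mul_mem (ih hB) (Subsemigroup.subset_closure ha)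

lemma mem_semigroup_iff {A : SL d} : A ∈ semigroup 𝒜 ↔ ∃ n : ℕ, A ∈ 𝒜 ^ (n + 1) := by
  refine ⟨fun h => ?_, fun ⟨n, h⟩ => mem_semigroup_of_mem_pow h⟩
  induction h using Subsemigroup.closure_induction with
  | mem x hx => exact ⟨0, by rwa [zero_add, pow_one]⟩
  | mul x y _ _ hx hy =>
    obtain ⟨n, hn⟩ := hx
    obtain ⟨m, hm⟩ := hy
    refine ⟨n + 1 + m, ?_⟩
    rw [add_assoc (n + 1), pow_add]
    exact Set.mul_mem_mul hn hm

lemma finite_pow (hfin : 𝒜.Finite) (n : ℕ) : (𝒜 ^ n).Finite := by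
  induction n with
  | zero => rw [pow_zero]; exact Set.finite_one
  | succ n ih => rw [pow_succ]; exact ih.mul hfin

lemma rank_smul_ne_one (hd : 2 ≤ d) (k : ℝ) (A : SL d) :
    (k • (A : Matrix (Fin d) (Fin d) ℝ)).rank ≠ 1 := by
  rcases eq_or_ne k 0 with rfl | hk
  · simp
  · have : IsUnit (k • (A : Matrix (Fin d) (Fin d) ℝ)) := by
      rw [Matrix.isUnit_iff_isUnit_det, Matrix.det_smul, A.det_coe, mul_one]
      exact (isUnit_iff_ne_zero.mpr hk).pow _
    rw [Matrix.rank_of_isUnit _ this, Fintype.card_fin]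
    omega

lemma isClosed_line (A : SL d) :
    IsClosed {N | ∃ k : ℝ, N = k • (A : Matrix (Fin d) (Fin d) ℝ)} := by
  convert (Submodule.span ℝ {(A : Matrix (Fin d) (Fin d) ℝ)}).closed_of_finiteDimensional
  ext N
  simp [Submodule.mem_span_singleton, eq_comm]

/-- A rank one element of the closure of `ℝG` is a limit of multiples of arbitrarily long
products. -/
lemma mem_closure_long_products (hd : 2 ≤ d) (hfin : 𝒜.Finite) {π : Matrix (Fin d) (Fin d) ℝ}
    (hπ : π ∈ closure (scalarMultiples 𝒜)) (hr : π.rank = 1) (m : ℕ) :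
    π ∈ closure {N | ∃ k : ℝ, ∃ n, m ≤ n ∧ ∃ A ∈ 𝒜 ^ n,
      N = k • (A : Matrix (Fin d) (Fin d) ℝ)} := by
  set L := {N | ∃ k : ℝ, ∃ n, m ≤ n ∧ ∃ A ∈ 𝒜 ^ n, N = k • (A : Matrix (Fin d) (Fin d) ℝ)}
  have hfin' : (⋃ n ∈ Set.Iio m, 𝒜 ^ n).Finite :=
    (Set.finite_Iio m).biUnion fun n _ => finite_pow hfin n
  -- Short products contribute finitely many lines of matrices, a closed set whose elements have
  -- rank `0` or `d`, never one.
  set S := ⋃ A ∈ ⋃ n ∈ Set.Iio m, 𝒜 ^ n,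
    {N | ∃ k : ℝ, N = k • (A : Matrix (Fin d) (Fin d) ℝ)} with hS
  have hSc : IsClosed S := hfin'.isClosed_biUnion fun A _ => isClosed_line A
  have hsub : scalarMultiples 𝒜 ⊆ L ∪ S := by
    rintro _ ⟨k, A, hA, rfl⟩
    obtain ⟨n, hn⟩ := mem_semigroup_iff.mp hA
    rcases le_or_gt m (n + 1) with h | h
    · exact Or.inl ⟨k, n + 1, h, A, hn, rfl⟩
    · exact Or.inr (Set.mem_biUnion (Set.mem_biUnion (Set.mem_Iio.mpr h) hn) ⟨k, rfl⟩)
  have h1 := closure_mono hsub hπ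
  rw [closure_union, hSc.closure_eq] at h1
  refine h1.resolve_right fun h2 => ?_
  obtain ⟨A, -, k, rfl⟩ := Set.mem_iUnion₂.mp h2
  exact rank_smul_ne_one hd k A hr

lemma rank_mul_left (A : SL d) (π : Matrix (Fin d) (Fin d) ℝ) :
    ((A : Matrix (Fin d) (Fin d) ℝ) * π).rank = π.rank :=
  Matrix.rank_mul_eq_right_of_isUnit_det _ _ (by rw [A.det_coe]; exact isUnit_one)

lemma range_lin_mul (M N : Matrix (Fin d) (Fin d) ℝ) :
    LinearMap.range (lin (M * N)) = (LinearMap.range (lin N)).map (lin M) := by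
  rw [← LinearMap.range_comp]
  congr 1
  ext1 x
  exact congrArg (fun f => f x) (opMap_mul M N)

lemma projMap_mem_limitSet_of_mem {a : SL d} (ha : a ∈ 𝒜) {x : RP d} (hx : x ∈ limitSet 𝒜) :
    projMap a x ∈ limitSet 𝒜 := by
  obtain ⟨π, hπ, hr, hx⟩ := hx
  refine ⟨a * π, ?_, by rw [rank_mul_left, hr], ?_⟩
  · refine map_mem_closure (f := fun N => (a : Matrix (Fin d) (Fin d) ℝ) * N)
      (continuous_const.matrix_mul continuous_id) hπ ?_
    rintro _ ⟨k, A, hA, rfl⟩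
    exact ⟨k, a * A, mul_mem (Subsemigroup.subset_closure ha) hA, by simp⟩
  · rw [submodule_projMap, hx, range_lin_mul]

lemma exists_projMap_eq_of_mem_limitSet (hd : 2 ≤ d) (hfin : 𝒜.Finite) {x : RP d}
    (hx : x ∈ limitSet 𝒜) : ∃ a ∈ 𝒜, ∃ y ∈ limitSet 𝒜, projMap a y = x := by
  obtain ⟨π, hπ, hr, hx⟩ := hx
  -- Length at least two, so that stripping the leftmost factor leaves an element of the semigroup.
  -- Finiteness of `𝒜` then lets one factor `a` serve for the limit.
  have h1 := mem_closure_long_products hd hfin hπ hr 2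
  set T := ⋃ a ∈ 𝒜, (fun N => ((a⁻¹ : SL d) : Matrix (Fin d) (Fin d) ℝ) * N) ⁻¹'
    closure (scalarMultiples 𝒜) with hT
  have hTc : IsClosed T := hfin.isClosed_biUnion fun a _ =>
    isClosed_closure.preimage (continuous_const.matrix_mul continuous_id)
  have h2 : π ∈ T := by
    refine closure_minimal ?_ hTc h1
    rintro _ ⟨k, n, hn, A, hA, rfl⟩
    obtain ⟨n, rfl⟩ := Nat.exists_eq_add_of_le' hn
    rw [pow_succ'] at hA
    obtain ⟨a, ha, B, hB, rfl⟩ := Set.mem_mul.mp hA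
    refine Set.mem_biUnion ha (subset_closure ⟨k, B, mem_semigroup_of_mem_pow hB, ?_⟩)
    have h4 : (((a⁻¹ : SL d) * (a * B) : SL d) : Matrix (Fin d) (Fin d) ℝ) = B := by
      rw [inv_mul_cancel_left]
    rw [← h4, Matrix.SpecialLinearGroup.coe_mul]
    exact Matrix.mul_smul _ _ _
  obtain ⟨a, ha, h3⟩ := Set.mem_iUnion₂.mp h2
  have hrank := rank_mul_left a⁻¹ π
  rw [hr] at hrank
  have hmem : projMap a⁻¹ x ∈ limitSet 𝒜 :=
    ⟨_, h3, hrank, by rw [submodule_projMap, hx, range_lin_mul]⟩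
  exact ⟨a, ha, _, hmem, by rw [← projMap_mul, mul_inv_cancel, projMap_one]⟩

lemma ifs_limitSet (hd : 2 ≤ d) (hfin : 𝒜.Finite) : ifs 𝒜 (limitSet 𝒜) = limitSet 𝒜 := by
  ext x
  simp only [ifs, Set.mem_iUnion, Set.mem_image, exists_prop]
  constructor
  · rintro ⟨a, ha, y, hy, rfl⟩
    exact projMap_mem_limitSet_of_mem ha hy
  · intro hx
    exact exists_projMap_eq_of_mem_limitSet hd hfin hx

lemma iterate_ifs (B : Set (RP d)) (n : ℕ) :
    (ifs 𝒜)^[n] B = ⋃ A ∈ 𝒜 ^ n, projMap A '' B := by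
  induction n with
  | zero =>
    ext x
    simp [projMap_one]
  | succ n ih =>
    rw [Function.iterate_succ_apply', ih, pow_succ']
    ext x
    simp only [ifs, Set.mem_iUnion, Set.mem_image, exists_prop, Set.mem_mul]
    constructor
    · rintro ⟨a, ha, y, ⟨A, hA, z, hz, rfl⟩, rfl⟩
      exact ⟨_, ⟨a, ha, A, hA, rfl⟩, z, hz, projMap_mul _ _ _⟩
    · rintro ⟨_, ⟨a, ha, A, hA, rfl⟩, z, hz, rfl⟩
      exact ⟨a, ha, _, ⟨A, hA, z, hz, rfl⟩, (projMap_mul _ _ _).symm⟩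

lemma mem_iterate_ifs {B : Set (RP d)} {n : ℕ} {x : RP d} :
    x ∈ (ifs 𝒜)^[n] B ↔ ∃ A ∈ 𝒜 ^ n, ∃ y ∈ B, projMap A y = x := by
  simp [iterate_ifs]

lemma iterate_ifs_limitSet (hd : 2 ≤ d) (hfin : 𝒜.Finite) (n : ℕ) :
    (ifs 𝒜)^[n] (limitSet 𝒜) = limitSet 𝒜 :=
  Function.iterate_fixed (ifs_limitSet hd hfin) n

/-- A point of the limit set is represented by the value of a rank one matrix. -/
lemma exists_vector_of_mem_limitSet {x : RP d} (hx : x ∈ limitSet 𝒜) :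
    ∃ π ∈ closure (scalarMultiples 𝒜), π.rank = 1 ∧ (∀ z, opMap π z ∈ x.submodule) ∧
      ∃ z, opMap π z ≠ 0 := by
  obtain ⟨π, hπ, hr, hx⟩ := hx
  refine ⟨π, hπ, hr, fun z => by rw [hx]; exact LinearMap.mem_range_self _ z, ?_⟩
  have h := rep_mem_submodule x
  rw [hx] at h
  obtain ⟨z, hz⟩ := h
  exact ⟨z, by rw [opMap_apply, hz]; exact x.rep_nonzero⟩

end

/-! ### Behaviour of long products on the limit set. -/

section

variable {d : ℕ}

lemma acuteAngle_eq_of_mem {p : RP d} {w w' : Euc d} (hw : w ≠ 0) (hw' : w' ≠ 0)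
    (hp : w ∈ p.submodule) (hp' : w' ∈ p.submodule) (y : Euc d) :
    acuteAngle w y = acuteAngle w' y := by
  rw [Projectivization.submodule_eq, Submodule.mem_span_singleton] at hp hp'
  obtain ⟨a, rfl⟩ := hp
  obtain ⟨b, rfl⟩ := hp'
  rw [acuteAngle_smul_left _ _ (left_ne_zero_of_smul hw),
    acuteAngle_smul_left _ _ (left_ne_zero_of_smul hw')]

namespace RankOneApprox

variable {𝒜 : Set (SL d)} {u v : SL d → Euc d} {C τ M : ℝ}

lemma u_ne_zero (h : RankOneApprox 𝒜 u v C τ M) (A : SL d) : u A ≠ 0 :=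
  norm_ne_zero_iff.mp (by rw [h.norm_u]; exact one_ne_zero)

lemma tendsto_mul_pow (h : RankOneApprox 𝒜 u v C τ M) (c : ℝ) :
    Tendsto (fun n : ℕ => c * τ ^ n) atTop (𝓝 0) := by
  simpa using (tendsto_pow_atTop_nhds_zero_of_lt_one h.τ_pos.le h.τ_lt_one).const_mul c

/-- Products of length `n` send the limit set close to their dominant direction. -/
lemma angle_le_of_mem_limitSet (h : RankOneApprox 𝒜 u v C τ M) (hd : 2 ≤ d) (hfin : 𝒜.Finite)
    {x : RP d} (hx : x ∈ limitSet 𝒜) {w : Euc d} (hw : w ≠ 0) (hwx : w ∈ x.submodule) {n : ℕ}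
    {A : SL d} (hA : A ∈ 𝒜 ^ n) :
    acuteAngle (act A w) (u A) ≤ 2 * C * M ^ 2 / (1 - τ) * τ ^ n := by
  obtain ⟨π, hπ, hr, hπx, z, hz⟩ := exists_vector_of_mem_limitSet hx
  have hC := h.C_pos
  have hτ := h.τ_pos
  rw [acuteAngle_eq_of_mem (act_ne_zero A hw) (act_ne_zero A hz) (act_mem_submodule A hwx)
    (act_mem_submodule A (hπx z))]
  set D := 2 * C * M ^ 2 / (1 - τ) * τ ^ n
  have hc1 : ContinuousAt (fun N : Matrix (Fin d) (Fin d) ℝ => opMap N z) π :=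
    (continuous_opMap.clm_apply continuous_const).continuousAt
  have hc2 : ContinuousAt (fun N : Matrix (Fin d) (Fin d) ℝ => act A (opMap N z)) π :=
    (act A).continuous.continuousAt.comp hc1
  have hev : ∀ᶠ N in 𝓝 π, opMap N z ≠ 0 := hc1.eventually_ne hz
  -- Two limits: for fixed `m`, `N = k • B` tends to `π` along products `B` of length at least `m`;
  -- then `m` tends to infinity. Multiplying by the norm keeps both sides continuous at `π`.
  have key : ∀ m : ℕ, ‖act A (opMap π z)‖ * (acuteAngle (act A (opMap π z)) (u A) - D)
      ≤ 2 * C * τ ^ m * (‖act A‖ * ‖opMap π‖) * ‖z‖ := by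
    intro m
    have hfr := (mem_closure_iff_frequently.mp
      (mem_closure_long_products hd hfin hπ hr m)).and_eventually hev
    refine le_of_tendsto_of_tendsto_of_frequently
      (f := fun N => ‖act A (opMap N z)‖ * (acuteAngle (act A (opMap N z)) (u A) - D))
      (g := fun N => 2 * C * τ ^ m * (‖act A‖ * ‖opMap N‖) * ‖z‖) (b := 𝓝 π) ?_ ?_ ?_
    · exact hc2.norm.tendsto.mul ((tendsto_acuteAngle (act_ne_zero A hz) (h.u_ne_zero A)
        hc2.tendsto tendsto_const_nhds).sub tendsto_const_nhds)
    · exact (((continuous_opMap.norm.const_mul _).const_mul _).mul_const _).tendsto π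
    · refine hfr.mono ?_
      rintro _ ⟨⟨k, j, hj, B, hB, rfl⟩, hN⟩
      have hk : k ≠ 0 := by
        rintro rfl
        exact hN (by rw [opMap_smul]; exact zero_smul ℝ (act B z))
      have e1 : act A (opMap (k • (B : Matrix (Fin d) (Fin d) ℝ)) z) = k • act (A * B) z := by
        rw [act_mul_apply, opMap_smul]
        exact (act A).map_smul k (act B z)
      have hAB : A * B ∈ 𝒜 ^ (n + j) := by rw [pow_add]; exact Set.mul_mem_mul hA hB
      have h1 := h.norm_mul_angle_le hAB z
      have h2 := h.angle_mul_le hd hA hB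
      have h3 := acuteAngle_triangle (act (A * B) z) (u (A * B)) (u A)
      rw [acuteAngle_comm (u (A * B))] at h3
      have h4 : acuteAngle (act (A * B) z) (u A) - D ≤ acuteAngle (act (A * B) z) (u (A * B)) := by
        linarith
      have h5 : τ ^ (n + j) ≤ τ ^ m :=
        pow_le_pow_of_le_one hτ.le h.τ_lt_one.le (hj.trans (Nat.le_add_left _ _))
      rw [e1, acuteAngle_smul_left _ _ hk, opMap_smul, norm_smul, norm_smul]
      calc ‖k‖ * ‖act (A * B) z‖ * (acuteAngle (act (A * B) z) (u A) - D)
          ≤ ‖k‖ * ‖act (A * B) z‖ * acuteAngle (act (A * B) z) (u (A * B)) := by gcongr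
        _ = ‖k‖ * (‖act (A * B) z‖ * acuteAngle (act (A * B) z) (u (A * B))) := by ring
        _ ≤ ‖k‖ * (2 * C * τ ^ (n + j) * ‖act (A * B)‖ * ‖z‖) := by gcongr
        _ ≤ ‖k‖ * (2 * C * τ ^ m * (‖act A‖ * ‖act B‖) * ‖z‖) := by
            gcongr; exact norm_act_mul_le A B
        _ = 2 * C * τ ^ m * (‖act A‖ * (‖k‖ * ‖act B‖)) * ‖z‖ := by ring
  have hlim : Tendsto (fun m : ℕ => 2 * C * τ ^ m * (‖act A‖ * ‖opMap π‖) * ‖z‖) atTop (𝓝 0) := by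
    simpa using ((h.tendsto_mul_pow (2 * C)).mul_const (‖act A‖ * ‖opMap π‖)).mul_const ‖z‖
  have h6 := ge_of_tendsto' hlim key
  have h7 : 0 < ‖act A (opMap π z)‖ := norm_pos_iff.mpr (act_ne_zero A hz)
  by_contra hlt
  exact absurd h6 (not_le.mpr (mul_pos h7 (sub_pos.mpr (not_le.mp hlt))))

/-- Matrices of the semigroup contract no direction of the limit set relative to their norm. -/
lemma exists_norm_mul_le (h : RankOneApprox 𝒜 u v C τ M) (hd : 2 ≤ d) (hfin : 𝒜.Finite) :
    ∃ K, 1 ≤ K ∧ ∀ n, ∀ A ∈ 𝒜 ^ n, ∀ x ∈ limitSet 𝒜, ∀ w ∈ x.submodule,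
      ‖act A‖ * ‖w‖ ≤ K * ‖act A w‖ := by
  have hC := h.C_pos
  have hτ := h.τ_pos
  have hτ1 : 0 < 1 - τ := sub_pos.mpr h.τ_lt_one
  have hM := h.M_pos
  set D := 2 * C * M ^ 2 / (1 - τ) with hD
  have hD0 : 0 ≤ D := by positivity
  -- `2 * C + D` bounds how far images under `B` stray from the line of `B w`. One factor `M` bounds
  -- `‖a‖`, the other comes from `1 ≤ M * ‖a e‖`.
  set F := M ^ 2 * (2 * C + D) with hF
  have hF0 : 0 ≤ F := by positivity
  have key : ∀ n, ∀ A ∈ 𝒜 ^ n, ∀ x ∈ limitSet 𝒜, ∀ w ∈ x.submodule,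
      ‖act A‖ * ‖w‖ ≤ (∏ j ∈ Finset.range n, (1 + F * τ ^ j)) * ‖act A w‖ := by
    intro n
    induction n with
    | zero =>
      intro A hA x _ w _
      rw [pow_zero, Set.mem_one] at hA
      rw [hA, act_one, Finset.prod_range_zero, one_mul]
      exact mul_le_of_le_one_left (norm_nonneg w) ContinuousLinearMap.norm_id_le
    | succ n ih =>
      intro A hA x hx w hw
      rcases eq_or_ne w 0 with rfl | hw0
      · simp
      rw [pow_succ'] at hA
      obtain ⟨a, ha, B, hB, rfl⟩ := Set.mem_mul.mp hA
      set y := act B w with hy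
      have hy0 : y ≠ 0 := act_ne_zero B hw0
      have hyn : 0 < ‖y‖ := norm_pos_iff.mpr hy0
      set e := ‖y‖⁻¹ • y with he
      have hen : ‖e‖ = 1 := norm_smul_inv_norm hy0
      have hay : ‖y‖ ≤ M * ‖act a y‖ := (norm_le_norm_act_inv_mul a y).trans
        (by gcongr; exact h.norm_act_inv_le a ha)
      have hae : ‖act a e‖ = ‖act a y‖ / ‖y‖ := by
        rw [he, map_smul, norm_smul, norm_inv, norm_norm, inv_mul_eq_div]
      have hone : 1 ≤ M * (‖act a y‖ / ‖y‖) := by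
        rw [← mul_div_assoc, one_le_div hyn]; exact hay
      -- Every `B q` is its component along `e` plus an error `z` of relative size `τ ^ n`, so `‖a *
      -- B‖` is nearly at most `‖B‖ ‖a e‖`, while `‖a (B w)‖` is exactly `‖a e‖ ‖B w‖`.
      have hbound : ‖act (a * B)‖ ≤ ‖act B‖ * (‖act a y‖ / ‖y‖) * (1 + F * τ ^ n) := by
        refine ContinuousLinearMap.opNorm_le_bound _ (by positivity) fun q => ?_
        have h1 := norm_sub_proj_le (act B q) hen
        have h2 := h.norm_mul_angle_le hB q
        have h3 := h.angle_le_of_mem_limitSet hd hfin hx hw0 hw hB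
        have h4 := acuteAngle_triangle (act B q) (u B) e
        rw [he, acuteAngle_smul_right _ _ (inv_pos.mpr hyn).ne', acuteAngle_smul_right _ _
          (inv_pos.mpr hyn).ne', acuteAngle_comm (u B)] at h4
        rw [he, acuteAngle_smul_right _ _ (inv_pos.mpr hyn).ne', ← he] at h1
        have hBq := (act B).le_opNorm q
        set z := act B q - (inner ℝ e (act B q) : ℝ) • e with hz
        have hzn : ‖z‖ ≤ (2 * C + D) * τ ^ n * (‖act B‖ * ‖q‖) := by
          calc ‖z‖ ≤ ‖act B q‖ * (acuteAngle (act B q) (u B) + D * τ ^ n) := by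
                refine h1.trans ?_
                gcongr
                exact h4.trans (by gcongr)
            _ = ‖act B q‖ * acuteAngle (act B q) (u B) + ‖act B q‖ * (D * τ ^ n) := by ring
            _ ≤ 2 * C * τ ^ n * ‖act B‖ * ‖q‖ + ‖act B‖ * ‖q‖ * (D * τ ^ n) := by gcongr
            _ = _ := by ring
        have hc : ‖(inner ℝ e (act B q) : ℝ)‖ ≤ ‖act B‖ * ‖q‖ := by
          refine (norm_inner_le_norm _ _).trans ?_
          rw [hen, one_mul]; exact hBq
        have hdec : act (a * B) q = (inner ℝ e (act B q) : ℝ) • act a e + act a z := by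
          rw [act_mul_apply, ← map_smul, ← map_add, hz, add_sub_cancel]
        calc ‖act (a * B) q‖ ≤ ‖(inner ℝ e (act B q) : ℝ)‖ * ‖act a e‖ + ‖act a‖ * ‖z‖ := by
              rw [hdec, ← norm_smul]
              exact (norm_add_le _ _).trans (by gcongr; exact (act a).le_opNorm z)
          _ ≤ ‖act B‖ * ‖q‖ * (‖act a y‖ / ‖y‖)
              + M * ((2 * C + D) * τ ^ n * (‖act B‖ * ‖q‖)) * 1 := by
              rw [hae, mul_one]; gcongr; exact h.norm_act_le a ha
          _ ≤ ‖act B‖ * ‖q‖ * (‖act a y‖ / ‖y‖)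
              + M * ((2 * C + D) * τ ^ n * (‖act B‖ * ‖q‖)) * (M * (‖act a y‖ / ‖y‖)) := by
              gcongr
          _ = ‖act B‖ * (‖act a y‖ / ‖y‖) * (1 + F * τ ^ n) * ‖q‖ := by rw [hF]; ring
      have hih := ih B hB x hx w hw
      rw [Finset.prod_range_succ, act_mul_apply]
      calc ‖act (a * B)‖ * ‖w‖ ≤ ‖act B‖ * (‖act a y‖ / ‖y‖) * (1 + F * τ ^ n) * ‖w‖ := by gcongr
        _ = (‖act B‖ * ‖w‖) * ((‖act a y‖ / ‖y‖) * (1 + F * τ ^ n)) := by ring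
        _ ≤ (∏ j ∈ Finset.range n, (1 + F * τ ^ j)) * ‖y‖
            * ((‖act a y‖ / ‖y‖) * (1 + F * τ ^ n)) := by gcongr
        _ = _ := by rw [← hy]; field_simp
  refine ⟨Real.exp (F * (1 - τ)⁻¹), Real.one_le_exp (by positivity), fun n A hA x hx w hw =>
    (key n A hA x hx w hw).trans ?_⟩
  gcongr
  calc ∏ j ∈ Finset.range n, (1 + F * τ ^ j) ≤ ∏ j ∈ Finset.range n, Real.exp (F * τ ^ j) := by
        refine Finset.prod_le_prod (fun j _ => by positivity) fun j _ => ?_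
        rw [add_comm]; exact Real.add_one_le_exp _
    _ = Real.exp (F * ∑ j ∈ Finset.range n, τ ^ j) := by rw [← Real.exp_sum, Finset.mul_sum]
    _ ≤ _ := by
        gcongr
        rw [← tsum_geometric_of_lt_one hτ.le h.τ_lt_one]
        exact (summable_geometric_of_lt_one hτ.le h.τ_lt_one).sum_le_tsum _
          fun _ _ => by positivity

end RankOneApprox

end

/-! ### Compactness, contraction near the limit set, and existence of the attractor. -/

section

variable {d : ℕ}

instance compactSpace_RP : CompactSpace (RP d) := by
  let f : Metric.sphere (0 : Euc d) 1 → RP d := fun w =>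
    Projectivization.mk ℝ (w : Euc d) (ne_zero_of_mem_unit_sphere w)
  have hf : Continuous f := by
    rw [continuous_iff_continuousAt]
    intro w
    have hw := ne_zero_of_mem_unit_sphere w
    rw [ContinuousAt, tendsto_iff_dist_tendsto_zero]
    simp only [f, dist_mk_mk]
    rw [← acuteAngle_self hw]
    exact tendsto_acuteAngle hw hw continuous_subtype_val.continuousAt tendsto_const_nhds
  have hs : Function.Surjective f := by
    intro p
    refine ⟨⟨‖p.rep‖⁻¹ • p.rep, by simpa using norm_smul_inv_norm (𝕜 := ℝ) p.rep_nonzero⟩, ?_⟩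
    exact (eq_mk_of_mem_submodule _ (Submodule.smul_mem _ _ (rep_mem_submodule p))).symm
  rw [← isCompact_univ_iff, ← hs.range_eq]
  exact isCompact_range hf

lemma opMap_vecMulVec (a b : Euc d) (x : Euc d) :
    opMap (Matrix.vecMulVec a.ofLp b.ofLp) x = (inner ℝ b x : ℝ) • a := by
  ext i
  simp only [opMap, Matrix.ofLp_toEuclideanCLM, Matrix.vecMulVec_mulVec, PiLp.smul_apply,
    smul_eq_mul, PiLp.inner_apply, dotProduct]
  simp [mul_comm]

lemma range_lin_vecMulVec {a b : Euc d} (ha : a ≠ 0) (hb : b ≠ 0) :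
    (Projectivization.mk ℝ a ha).submodule
      = LinearMap.range (lin (Matrix.vecMulVec a.ofLp b.ofLp)) := by
  rw [Projectivization.submodule_mk]
  refine le_antisymm ?_ ?_
  · rw [Submodule.span_singleton_le_iff_mem]
    refine ⟨(inner ℝ b b : ℝ)⁻¹ • b, ?_⟩
    rw [← opMap_apply, opMap_vecMulVec, inner_smul_right,
      inv_mul_cancel₀ (inner_self_ne_zero.mpr hb), one_smul]
  · rintro _ ⟨x, rfl⟩
    rw [← opMap_apply, opMap_vecMulVec]
    exact Submodule.smul_mem _ _ (Submodule.mem_span_singleton_self a)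

lemma rank_vecMulVec_eq_one {a b : Euc d} (ha : a ≠ 0) (hb : b ≠ 0) :
    (Matrix.vecMulVec a.ofLp b.ofLp).rank = 1 := by
  rw [Matrix.rank_eq_finrank_range_toLin _ (EuclideanSpace.basisFun (Fin d) ℝ).toBasis
    (EuclideanSpace.basisFun (Fin d) ℝ).toBasis, ← Matrix.toEuclideanLin_eq_toLin_orthonormal,
    ← range_lin_vecMulVec ha hb, Projectivization.finrank_submodule]

namespace RankOneApprox

variable {𝒜 : Set (SL d)} {u v : SL d → Euc d} {C τ M : ℝ}

/-- Dominant directions of longer and longer products accumulate on the limit set. -/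
lemma exists_subseq_tendsto (h : RankOneApprox 𝒜 u v C τ M) (hd : 2 ≤ d) {A : ℕ → SL d}
    (hA : ∀ n, A n ∈ 𝒜 ^ n) :
    ∃ (w : Euc d) (hw : w ≠ 0) (φ : ℕ → ℕ), StrictMono φ ∧
      Tendsto (fun n => u (A (φ n))) atTop (𝓝 w) ∧ Projectivization.mk ℝ w hw ∈ limitSet 𝒜 := by
  obtain ⟨⟨w, y⟩, ⟨hw, hy⟩, φ, hφ, hlim⟩ :=
    ((isCompact_sphere (0 : Euc d) 1).prod (isCompact_sphere (0 : Euc d) 1)).tendsto_subseq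
      (x := fun n => (u (A n), v (A n))) fun n => ⟨by simp [h.norm_u], by simp [h.norm_v]⟩
  have hlu : Tendsto (fun n => u (A (φ n))) atTop (𝓝 w) :=
    (continuous_fst.tendsto _).comp hlim
  have hlv : Tendsto (fun n => v (A (φ n))) atTop (𝓝 y) :=
    (continuous_snd.tendsto _).comp hlim
  have hw0 : w ≠ 0 := ne_zero_of_mem_unit_sphere (⟨w, hw⟩ : Metric.sphere (0 : Euc d) 1)
  have hy0 : y ≠ 0 := ne_zero_of_mem_unit_sphere (⟨y, hy⟩ : Metric.sphere (0 : Euc d) 1)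
  refine ⟨w, hw0, φ, hφ, hlu, Matrix.vecMulVec w.ofLp y.ofLp, ?_,
    rank_vecMulVec_eq_one hw0 hy0, range_lin_vecMulVec hw0 hy0⟩
  have happly : ∀ x : Euc d, Tendsto (fun n => ‖act (A (φ n))‖⁻¹ • act (A (φ n)) x) atTop
      (𝓝 ((inner ℝ y x : ℝ) • w)) := by
    intro x
    have h1 : Tendsto (fun n => (inner ℝ (v (A (φ n))) x : ℝ) • u (A (φ n))) atTop
        (𝓝 ((inner ℝ y x : ℝ) • w)) := (hlv.inner tendsto_const_nhds).smul hlu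
    have h2 : Tendsto (fun n => ‖act (A (φ n))‖⁻¹ • act (A (φ n)) x
        - (inner ℝ (v (A (φ n))) x : ℝ) • u (A (φ n))) atTop (𝓝 0) := by
      have hb : Tendsto (fun n => C * τ ^ φ n * ‖x‖) atTop (𝓝 0) := by
        simpa using ((h.tendsto_mul_pow C).comp hφ.tendsto_atTop).mul_const ‖x‖
      refine squeeze_zero_norm (fun n => ?_) hb
      have hpos := norm_act_pos hd (A (φ n))
      have h3 := h.approx _ _ (hA (φ n)) x
      have h4 : ‖act (A (φ n))‖⁻¹ • act (A (φ n)) x - (inner ℝ (v (A (φ n))) x : ℝ) • u (A (φ n))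
          = ‖act (A (φ n))‖⁻¹ • (act (A (φ n)) x
            - (‖act (A (φ n))‖ * inner ℝ (v (A (φ n))) x) • u (A (φ n))) := by
        rw [smul_sub, smul_smul, inv_mul_cancel_left₀ hpos.ne']
      rw [h4, norm_smul, norm_inv, norm_norm, inv_mul_le_iff₀ hpos]
      linarith
    simpa using h2.add h1
  refine mem_closure_of_tendsto (f := fun n =>
    ‖act (A (φ n))‖⁻¹ • (A (φ n) : Matrix (Fin d) (Fin d) ℝ)) (b := atTop) ?_ ?_
  -- Pointwise convergence on the standard basis vectors is convergence of the columns.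
  · refine tendsto_pi_nhds.mpr fun i => tendsto_pi_nhds.mpr fun j => ?_
    have h1 := ((EuclideanSpace.proj (𝕜 := ℝ) i).continuous.tendsto _).comp
      (happly (EuclideanSpace.single j 1))
    convert h1 using 1
    · ext n
      simp [act, opMap, Matrix.ofLp_toEuclideanCLM]
    · simp [Matrix.vecMulVec_apply, EuclideanSpace.inner_single_right, mul_comm]
  -- Index zero is excluded: `𝒜 ^ 0` is the identity, which need not lie in the semigroup.
  · filter_upwards [eventually_ge_atTop 1] with n hn
    obtain ⟨k, hk⟩ := Nat.exists_eq_add_of_le' (hn.trans (hφ.id_le n))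
    exact ⟨_, A (φ n), mem_semigroup_of_mem_pow (n := k) (by rw [← hk]; exact hA _), rfl⟩

lemma limitSet_nonempty (h : RankOneApprox 𝒜 u v C τ M) (hd : 2 ≤ d) (hne : 𝒜.Nonempty) :
    (limitSet 𝒜).Nonempty := by
  obtain ⟨a, ha⟩ := hne
  obtain ⟨w, hw, -, -, -, hmem⟩ := h.exists_subseq_tendsto hd (A := fun n => a ^ n)
    fun n => Set.pow_mem_pow ha
  exact ⟨_, hmem⟩

/-- By invariance, points of `Λ` are images under words of any length `n`. A closure point is thus
`O(τ ^ n)`-close to some dominant direction `u (A n)`, and these accumulate in `Λ`. -/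
lemma isClosed_limitSet (h : RankOneApprox 𝒜 u v C τ M) (hd : 2 ≤ d) (hfin : 𝒜.Finite) :
    IsClosed (limitSet 𝒜) := by
  refine isClosed_of_closure_subset fun x hx => ?_
  set D := 2 * C * M ^ 2 / (1 - τ)
  have key : ∀ n : ℕ, ∃ A ∈ 𝒜 ^ n, acuteAngle x.rep (u A) ≤ (1 + D) * τ ^ n := by
    intro n
    obtain ⟨y, hy, hxy⟩ := Metric.mem_closure_iff.mp hx (τ ^ n) (pow_pos h.τ_pos n)
    rw [← iterate_ifs_limitSet hd hfin n, mem_iterate_ifs] at hy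
    obtain ⟨A, hA, z, hz, rfl⟩ := hy
    refine ⟨A, hA, ?_⟩
    rw [dist_eq_acuteAngle x.rep_nonzero (act_ne_zero A z.rep_nonzero) (rep_mem_submodule x)
      (act_mem_submodule A (rep_mem_submodule z))] at hxy
    have h1 := h.angle_le_of_mem_limitSet hd hfin hz z.rep_nonzero (rep_mem_submodule z) hA
    have h2 := acuteAngle_triangle x.rep (act A z.rep) (u A)
    linarith
  choose A hA hAx using key
  obtain ⟨w, hw, φ, hφ, hlim, hmem⟩ := h.exists_subseq_tendsto hd hA
  have h1 := tendsto_acuteAngle x.rep_nonzero hw tendsto_const_nhds hlim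
  have h2 := le_of_tendsto_of_tendsto' h1 ((h.tendsto_mul_pow (1 + D)).comp hφ.tendsto_atTop)
    fun n => hAx (φ n)
  have h3 : x = Projectivization.mk ℝ w hw := by
    refine dist_le_zero.mp ?_
    rw [dist_eq_acuteAngle x.rep_nonzero hw (rep_mem_submodule x)
      (mem_submodule_mk hw)]
    exact h2
  rw [h3]; exact hmem

/-- Near the limit set, long products contract uniformly. -/
lemma exists_thickening_contracting (h : RankOneApprox 𝒜 u v C τ M) (hd : 2 ≤ d)
    (hfin : 𝒜.Finite) : ∃ r, 0 < r ∧ ∃ D, ∀ n, ∀ A ∈ 𝒜 ^ n, ∀ x ∈ limitSet 𝒜,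
      ∀ y ∈ Metric.thickening r (limitSet 𝒜), dist (projMap A y) (projMap A x) ≤ D * τ ^ n := by
  obtain ⟨K, hK1, hK⟩ := h.exists_norm_mul_le hd hfin
  have hK0 : 0 < K := one_pos.trans_le hK1
  have hC := h.C_pos
  have hτ := h.τ_pos
  -- With this radius the part of `w` off the line of `e` costs at most `‖A‖ / (4 * K)`, while the
  -- part along `e` keeps at least `3 / 4` of `‖A‖ / K`. The difference `‖A‖ / (2 * K)` bounds `‖A
  -- w‖` below.
  refine ⟨1 / (4 * K), by positivity, 4 * C * K + 2 * C * M ^ 2 / (1 - τ),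
    fun n A hA x hx y hy => ?_⟩
  obtain ⟨x', hx', hyx⟩ := Metric.mem_thickening_iff.mp hy
  have hpos := norm_act_pos hd A
  set e := ‖x'.rep‖⁻¹ • x'.rep with he
  have hen : ‖e‖ = 1 := norm_smul_inv_norm x'.rep_nonzero
  set w := ‖y.rep‖⁻¹ • y.rep with hw
  have hwn : ‖w‖ = 1 := norm_smul_inv_norm y.rep_nonzero
  have he0 : e ≠ 0 := norm_ne_zero_iff.mp (by rw [hen]; exact one_ne_zero)
  have hw0 : w ≠ 0 := norm_ne_zero_iff.mp (by rw [hwn]; exact one_ne_zero)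
  have hex : e ∈ x'.submodule := Submodule.smul_mem _ _ (rep_mem_submodule x')
  have hwy : w ∈ y.submodule := Submodule.smul_mem _ _ (rep_mem_submodule y)
  rw [dist_eq_acuteAngle hw0 he0 hwy hex] at hyx
  have hz := (norm_sub_proj_le w hen).trans (mul_le_mul_of_nonneg_left hyx.le (norm_nonneg w))
  rw [hwn, one_mul] at hz
  set t := (inner ℝ e w : ℝ) with ht
  set z := w - t • e with hzdef
  have hK4 : 1 / (4 * K) ≤ 1 / 4 := by
    rw [div_le_div_iff₀ (by positivity) (by positivity)]; linarith
  have ht1 : 3 / 4 ≤ ‖t‖ := by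
    have h1 : ‖w‖ ≤ ‖t • e‖ + ‖z‖ := by
      have : w = t • e + z := by rw [hzdef]; abel
      conv_lhs => rw [this]
      exact norm_add_le _ _
    rw [hwn, norm_smul t, hen, mul_one] at h1
    linarith
  have hlow : ‖act A‖ ≤ 2 * K * ‖act A w‖ := by
    have h1 := hK n A hA x' hx' e hex
    rw [hen, mul_one] at h1
    have h2 : ‖t‖ * ‖act A e‖ ≤ ‖act A w‖ + ‖act A‖ * ‖z‖ := by
      have : t • act A e = act A w - act A z := by
        rw [← map_smul, ← map_sub, hzdef, sub_sub_cancel]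
      rw [← norm_smul, this]
      exact (norm_sub_le _ _).trans (by gcongr; exact (act A).le_opNorm z)
    have h3 : ‖act A‖ * ‖z‖ ≤ ‖act A‖ * (1 / (4 * K)) := by gcongr
    have h4 : 3 / 4 * ‖act A e‖ ≤ ‖t‖ * ‖act A e‖ := by gcongr
    have h5 : K * (‖act A‖ * (1 / (4 * K))) = ‖act A‖ / 4 := by field_simp
    have h6 : K * (3 / 4 * ‖act A e‖) ≤ K * (‖act A w‖ + ‖act A‖ * (1 / (4 * K))) := by
      gcongr; linarith
    rw [mul_add, h5] at h6
    linarith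
  have hwA : 0 < ‖act A w‖ := norm_pos_iff.mpr (act_ne_zero A hw0)
  have h1 : acuteAngle (act A w) (u A) ≤ 4 * C * K * τ ^ n := by
    have h2 := h.norm_mul_angle_le hA w
    rw [hwn, mul_one] at h2
    refine le_of_mul_le_mul_left (h2.trans ?_) hwA
    calc 2 * C * τ ^ n * ‖act A‖ ≤ 2 * C * τ ^ n * (2 * K * ‖act A w‖) := by gcongr
      _ = ‖act A w‖ * (4 * C * K * τ ^ n) := by ring
  have h2 := h.angle_le_of_mem_limitSet hd hfin hx x.rep_nonzero (rep_mem_submodule x) hA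
  rw [dist_eq_acuteAngle (act_ne_zero A hw0) (act_ne_zero A x.rep_nonzero)
    (act_mem_submodule A hwy) (act_mem_submodule A (rep_mem_submodule x)), add_mul]
  refine (acuteAngle_triangle _ (u A) _).trans (add_le_add h1 ?_)
  rw [acuteAngle_comm]; exact h2

/-- Points of `𝒜^n(B)` and of `Λ = 𝒜^n(Λ)` are paired by using the same word on both sides. -/
lemma isAttractor_limitSet (h : RankOneApprox 𝒜 u v C τ M) (hd : 2 ≤ d) (hfin : 𝒜.Finite)
    (hne : 𝒜.Nonempty) : IsAttractor 𝒜 (limitSet 𝒜) := by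
  have hΛ := h.limitSet_nonempty hd hne
  obtain ⟨r, hr, D, hD⟩ := h.exists_thickening_contracting hd hfin
  refine ⟨hΛ, (h.isClosed_limitSet hd hfin).isCompact, ifs_limitSet hd hfin,
    Metric.thickening r (limitSet 𝒜), Metric.isOpen_thickening,
    Metric.self_subset_thickening hr _, fun B hB _ hBU => ?_⟩
  obtain ⟨x₀, hx₀⟩ := hΛ
  obtain ⟨y₀, hy₀⟩ := hB
  have hlim : Tendsto (fun n : ℕ => ENNReal.ofReal (D * τ ^ n)) atTop (𝓝 0) := by
    simpa using ENNReal.tendsto_ofReal (h.tendsto_mul_pow D)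
  refine tendsto_of_tendsto_of_tendsto_of_le_of_le tendsto_const_nhds hlim
    (fun _ => zero_le) fun n => ?_
  refine Metric.hausdorffEDist_le_of_mem_edist ?_ ?_
  · intro p hp
    obtain ⟨A, hA, y, hy, rfl⟩ := mem_iterate_ifs.mp hp
    refine ⟨projMap A x₀, ?_, ?_⟩
    · rw [← iterate_ifs_limitSet hd hfin n]
      exact mem_iterate_ifs.mpr ⟨A, hA, x₀, hx₀, rfl⟩
    · rw [edist_dist]
      exact ENNReal.ofReal_le_ofReal (hD n A hA x₀ hx₀ y (hBU hy))
  · intro p hp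
    rw [← iterate_ifs_limitSet hd hfin n] at hp
    obtain ⟨A, hA, x, hx, rfl⟩ := mem_iterate_ifs.mp hp
    refine ⟨projMap A y₀, mem_iterate_ifs.mpr ⟨A, hA, y₀, hy₀, rfl⟩, ?_⟩
    rw [edist_comm, edist_dist]
    exact ENNReal.ofReal_le_ofReal (hD n A hA x hx y₀ (hBU hy₀))

end RankOneApprox

/-! ### Uniqueness of the attractor. -/

variable {𝒜 : Set (SL d)}

/-- The orbit of any nonempty open set enters every neighbourhood of the limit set. -/
lemma exists_projMap_mem (hΛ : (limitSet 𝒜).Nonempty) {U W : Set (RP d)} (hU : IsOpen U)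
    (hUΛ : limitSet 𝒜 ⊆ U) (hW : IsOpen W) (hWne : W.Nonempty) :
    ∃ n, ∃ A ∈ 𝒜 ^ n, ∃ y ∈ W, projMap A y ∈ U := by
  obtain ⟨x, hx⟩ := hΛ
  obtain ⟨π, hπ, -, hπx, z, hz⟩ := exists_vector_of_mem_limitSet hx
  obtain ⟨p, hp⟩ := hWne
  -- The kernel of `π` is a proper subspace, so it contains no open set of lines: a point in it is
  -- pushed off along `z`.
  obtain ⟨w, hw0, hwW, hπw⟩ : ∃ (w : Euc d) (hw : w ≠ 0),
      Projectivization.mk ℝ w hw ∈ W ∧ opMap π w ≠ 0 := by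
    by_cases hp0 : opMap π p.rep = 0
    · obtain ⟨ε, hε, hball⟩ := Metric.isOpen_iff.mp hW p hp
      have hcont : Tendsto (fun t : ℝ => p.rep + t • z) (𝓝[≠] 0) (𝓝 p.rep) := by
        have : Tendsto (fun t : ℝ => p.rep + t • z) (𝓝 0) (𝓝 (p.rep + (0 : ℝ) • z)) :=
          (continuous_const.add (continuous_id.smul continuous_const)).tendsto 0
        rw [zero_smul, add_zero] at this
        exact this.mono_left nhdsWithin_le_nhds
      have h1 := tendsto_acuteAngle p.rep_nonzero p.rep_nonzero hcont tendsto_const_nhds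
      rw [acuteAngle_self p.rep_nonzero] at h1
      obtain ⟨t, ⟨ht1, ht2⟩, ht0⟩ := ((h1.eventually_lt_const hε).and
        (hcont.eventually_ne p.rep_nonzero) |>.and self_mem_nhdsWithin).exists
      refine ⟨p.rep + t • z, ht2, hball ?_, ?_⟩
      · rw [Metric.mem_ball, dist_eq_acuteAngle ht2 p.rep_nonzero
          (Submodule.mem_span_singleton_self _) (rep_mem_submodule p)]
        exact ht1
      · rw [map_add, hp0, zero_add, map_smul]
        exact smul_ne_zero ht0 hz
    · exact ⟨p.rep, p.rep_nonzero, by rwa [p.mk_rep], hp0⟩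
  obtain ⟨ε, hε, hball⟩ := Metric.isOpen_iff.mp hU x (hUΛ hx)
  have hc : Tendsto (fun N : Matrix (Fin d) (Fin d) ℝ => opMap N w) (𝓝 π) (𝓝 (opMap π w)) :=
    (continuous_opMap.clm_apply continuous_const).tendsto π
  have h1 := tendsto_acuteAngle hπw hπw hc tendsto_const_nhds
  rw [acuteAngle_self hπw] at h1
  obtain ⟨_, ⟨k, A, hA, rfl⟩, hN1, hN2⟩ := ((mem_closure_iff_frequently.mp hπ).and_eventually
    ((h1.eventually_lt_const hε).and (hc.eventually_ne hπw))).exists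
  obtain ⟨n, hn⟩ := mem_semigroup_iff.mp hA
  refine ⟨n + 1, A, hn, _, hwW, hball ?_⟩
  have hmem : opMap (k • (A : Matrix (Fin d) (Fin d) ℝ)) w
      ∈ (projMap A (Projectivization.mk ℝ w hw0)).submodule := by
    rw [opMap_smul]
    exact Submodule.smul_mem _ k (act_mem_submodule A (Submodule.mem_span_singleton_self w))
  rw [Metric.mem_ball, dist_eq_acuteAngle hN2 hπw hmem (hπx w)]
  exact hN1

lemma IsAttractor.eq_limitSet (hΛ : IsAttractor 𝒜 (limitSet 𝒜)) (hd : 2 ≤ d) (hfin : 𝒜.Finite)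
    {K : Set (RP d)} (hK : IsAttractor 𝒜 K) : K = limitSet 𝒜 := by
  obtain ⟨hΛne, hΛc, -, U, hU, hΛU, hUlim⟩ := hΛ
  obtain ⟨hKne, hKc, -, W, hW, hKW, hWlim⟩ := hK
  obtain ⟨m, A, hA, y, hy, hAy⟩ := exists_projMap_mem hΛne hU hΛU hW (hKne.mono hKW)
  have h1 := hUlim {projMap A y} (Set.singleton_nonempty _) isCompact_singleton
    (Set.singleton_subset_iff.mpr hAy)
  have h2 := (hWlim {y} (Set.singleton_nonempty _) isCompact_singleton
    (Set.singleton_subset_iff.mpr hy)).comp (tendsto_add_atTop_nat m)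
  -- The orbit of `A y` tends to `Λ` and sits, shifted by `m`, inside the orbit of `y`, which tends
  -- to `K`.
  have hsub : limitSet 𝒜 ⊆ K := by
    intro x hx
    rw [← hKc.isClosed.closure_eq, Metric.mem_closure_iff_infEDist_zero, ← nonpos_iff_eq_zero]
    have h3 := h1.add h2
    rw [add_zero] at h3
    refine ge_of_tendsto' h3 fun n => ?_
    have h4 : (ifs 𝒜)^[n] {projMap A y} ⊆ (ifs 𝒜)^[n + m] {y} := by
      intro p hp
      obtain ⟨B, hB, q, hq, rfl⟩ := mem_iterate_ifs.mp hp
      rw [Set.mem_singleton_iff.mp hq, ← projMap_mul]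
      refine mem_iterate_ifs.mpr ⟨B * A, ?_, y, rfl, rfl⟩
      rw [pow_add]
      exact Set.mul_mem_mul hB hA
    calc Metric.infEDist x K
        ≤ Metric.infEDist x ((ifs 𝒜)^[n + m] {y}) + Metric.hausdorffEDist ((ifs 𝒜)^[n + m] {y}) K :=
          Metric.infEDist_le_infEDist_add_hausdorffEDist
      _ ≤ Metric.hausdorffEDist ((ifs 𝒜)^[n] {projMap A y}) (limitSet 𝒜)
          + Metric.hausdorffEDist ((ifs 𝒜)^[n + m] {y}) K := by
          gcongr
          refine (Metric.infEDist_anti h4).trans ?_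
          rw [Metric.hausdorffEDist_comm]
          exact Metric.infEDist_le_hausdorffEDist_of_mem hx
  -- Now `Λ` itself is an admissible compact set in the basin of `K`, with constant iterates.
  have h5 := hWlim (limitSet 𝒜) hΛne hΛc (hsub.trans hKW)
  simp only [iterate_ifs_limitSet hd hfin] at h5
  have h6 := tendsto_nhds_unique h5 tendsto_const_nhds
  exact ((hΛc.isClosed.hausdorffEDist_zero_iff hKc.isClosed).mp h6.symm).symm

/-- The empty set generates the empty semigroup, which preserves every line; a line is a proper
subspace as `d ≥ 2`. -/
lemma Irred.nonempty (hd : 2 ≤ d) (hirr : Irred 𝒜) : 𝒜.Nonempty := by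
  by_contra hne
  rw [Set.not_nonempty_iff_eq_empty] at hne
  subst hne
  set e : Euc d := EuclideanSpace.single ⟨0, by omega⟩ 1
  have he : e ≠ 0 := norm_ne_zero_iff.mp (by simp [e])
  have h1 := finrank_span_singleton (K := ℝ) he
  rcases hirr (ℝ ∙ e) (fun A hA => by
    rw [semigroup, Subsemigroup.closure_empty] at hA
    exact absurd hA Subsemigroup.notMem_bot) with h | h
  · rw [h, finrank_bot] at h1; omega
  · rw [h, finrank_top, finrank_euclideanSpace_fin] at h1; omega

end

end SelfProjective

end

theorem theorem3p3 (d : ℕ) (hd : 2 ≤ d) (𝒜 : Set (SelfProjective.SL d)) (hfin : 𝒜.Finite)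
    (hdom : SelfProjective.OneDominated 𝒜) (hirr : SelfProjective.Irred 𝒜) :
    SelfProjective.IsAttractor 𝒜 (SelfProjective.limitSet 𝒜) ∧
      ∀ K : Set (SelfProjective.RP d),
        SelfProjective.IsAttractor 𝒜 K → K = SelfProjective.limitSet 𝒜 := by
  obtain ⟨u, v, C, τ, M, h⟩ := SelfProjective.exists_rankOneApprox hd hfin hdom
  have hatt := h.isAttractor_limitSet hd hfin (hirr.nonempty hd)
  exact ⟨hatt, fun K hK => hatt.eq_limitSet hd hfin hK⟩
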